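/- Let $R$ be a ring with $1$. For a left (or right) $R$-module $M$ let $M^*=\mathrm{Hom}_{\mathbb Z}(M,\mathbb Q/\mathbb Z)$, a module on the other side. All classes of modules are closed under isomorphism. For a class $\mathcal X$ of modules let $\mathcal X^*=\{M^*: M\in\mathcal X\}$, let $\mathcal X^+$ be its closure under pure submodules, $\mathrm{Prod}(\mathcal X)$ its closure under direct products and direct summands, and $\mathrm{Pinj}(\mathcal X)$ the class of pure-injective modules in $\mathcal X$. If $\mathcal S$ and $\mathcal P$ are classes of modules on opposite sides, $(\mathcal S,\mathcal P)$ is an almost dual pair if (1) $\mathcal P=\mathrm{Prod}(\mathcal P)$ and $\mathcal P$ is closed under pure-injective hulls, and (2) a module $M$ (on the same side as $\mathcal S$) lies in $\mathcal S$ if and only if $M^*\in\mathcal P$. It is a dual pair if moreover $\mathrm{Prod}(\mathcal S^*)=\mathrm{Pinj}(\mathcal P)$. A class of modules is a definable subcategory if it is closed under direct products, direct limits and pure submodules. Corollary 4.5. Let $\mathcal S$ be a class of left $R$-modules and $\mathcal P$ a class of right $R$-modules. If $(\mathcal S,\mathcal P)$ is an almost dual pair and $\mathcal P$ is a definable subcategory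 of $\mathrm{Mod}\text{-}R$, then $(\mathcal P,\mathcal S)$ is a dual pair (in particular an almost dual pair), and $\mathcal S=(\mathcal P^*)^+$. -/

import Mathlib

open CategoryTheory

universe u

namespace DualPairs

section Dual

variable {A B : Type u} [Ring A] [Ring B]

/-- Let `e` identify `B` with the opposite ring of `A`, so that left `B`-modules are the same as
right `A`-modules. For a left `A`-module `M`, this is the right `A`-module structure on
`Hom_ℤ(M, ℚ/ℤ)`, given by `(f · a)(m) = f (a m)`, regarded as a left `B`-module structure. -/
@[reducible] def charModule (e : B ≃+* Aᵐᵒᵖ) (M : Type u) [AddCommGroup M] [Module A M] :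
    Module B (CharacterModule M) where
  smul b f := AddMonoidHom.comp f (DistribSMul.toAddMonoidHom M (e b).unop)
  one_smul f := CharacterModule.ext _ fun m =>
    show f ((e 1).unop • m) = f m by simp
  mul_smul b c f := CharacterModule.ext _ fun m =>
    show f ((e (b * c)).unop • m) = f ((e c).unop • (e b).unop • m) by simp [mul_smul]
  smul_zero _ := rfl
  smul_add _ _ _ := rfl
  add_smul b c f := CharacterModule.ext _ fun m =>
    show f ((e (b + c)).unop • m) = f ((e b).unop • m) + f ((e c).unop • m) by simp [add_smul]
  zero_smul f := CharacterModule.ext _ fun m =>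
    show f ((e 0).unop • m) = 0 by simp

/-- The dual module `M^* = Hom_ℤ(M, ℚ/ℤ)`, a module on the other side. -/
def dual (e : B ≃+* Aᵐᵒᵖ) (M : ModuleCat.{u} A) : ModuleCat.{u} B :=
  letI := charModule e M
  ModuleCat.of B (CharacterModule M)

theorem dual_smul_apply (e : B ≃+* Aᵐᵒᵖ) (M : ModuleCat.{u} A) (b : B) (f : dual e M) (m : M) :
    (show CharacterModule M from b • f) m = (show CharacterModule M from f) ((e b).unop • m) :=
  rfl

/-- The class `X^* = {M^* : M ∈ X}`, closed under isomorphism. -/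
def dualClass (e : B ≃+* Aᵐᵒᵖ) (X : ObjectProperty (ModuleCat.{u} A)) :
    ObjectProperty (ModuleCat.{u} B) :=
  fun N => ∃ M, X M ∧ Nonempty (N ≅ dual e M)

end Dual

section Purity

variable {A : Type u} [Ring A]

/-- `f : L → M` is a pure monomorphism: it is injective, and every finite system of `A`-linear
equations with constants from `L` which has a solution in `M` has a solution in `L`. -/
def IsPureMono {L M : Type u} [AddCommGroup L] [Module A L] [AddCommGroup M] [Module A M]
    (f : L →ₗ[A] M) : Prop :=
  Function.Injective f ∧
    ∀ (m n : ℕ) (r : Fin m → Fin n → A) (c : Fin m → L),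
      (∃ y : Fin n → M, ∀ i, ∑ j, r i j • y j = f (c i)) →
        ∃ x : Fin n → L, ∀ i, ∑ j, r i j • x j = c i

/-- `N` is pure-injective: every homomorphism to `N` extends along every pure monomorphism. -/
def IsPureInjective (N : ModuleCat.{u} A) : Prop :=
  ∀ (L M : ModuleCat.{u} A) (f : L →ₗ[A] M), IsPureMono f →
    ∀ g : L →ₗ[A] N, ∃ h : M →ₗ[A] N, h ∘ₗ f = g

/-- `f : M → H` is a pure-injective hull of `M`: the module `H` is pure-injective, and `f` is a
pure monomorphism which is pure-essential. -/
def IsPureInjectiveHull {M H : ModuleCat.{u} A} (f : M →ₗ[A] H) : Prop :=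
  IsPureInjective H ∧ IsPureMono f ∧
    ∀ (K : ModuleCat.{u} A) (g : H →ₗ[A] K), IsPureMono (g ∘ₗ f) → IsPureMono g

/-- `Pinj(X)`: the pure-injective modules in `X`. -/
def pinj (X : ObjectProperty (ModuleCat.{u} A)) : ObjectProperty (ModuleCat.{u} A) :=
  fun N => X N ∧ IsPureInjective N

/-- `Prod(X)`: the closure of `X` under direct products and direct summands. -/
inductive prodClosure (X : ObjectProperty (ModuleCat.{u} A)) : ObjectProperty (ModuleCat.{u} A)
  | of_mem (M : ModuleCat.{u} A) (hM : X M) : prodClosure X M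
  | prod (I : Type u) (M : I → ModuleCat.{u} A) (hM : ∀ i, prodClosure X (M i)) :
      prodClosure X (ModuleCat.of A (∀ i, M i))
  | summand (M N : ModuleCat.{u} A) (s : N →ₗ[A] M) (p : M →ₗ[A] N)
      (hps : p ∘ₗ s = LinearMap.id) (hM : prodClosure X M) : prodClosure X N

/-- `X⁺`: the closure of `X` under pure submodules. -/
def pureClosure (X : ObjectProperty (ModuleCat.{u} A)) : ObjectProperty (ModuleCat.{u} A) :=
  fun M => ∃ N, X N ∧ ∃ f : M →ₗ[A] N, IsPureMono f

/-- `X` is a definable subcategory: it is closed under direct products, direct limits (of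
directed systems) and pure submodules. -/
structure IsDefinable (X : ObjectProperty (ModuleCat.{u} A)) : Prop where
  prod : ∀ (I : Type u) (M : I → ModuleCat.{u} A), (∀ i, X (M i)) →
    X (ModuleCat.of A (∀ i, M i))
  directLimit : ∀ (ι : Type u) [Preorder ι] [IsDirectedOrder ι] [Nonempty ι] [DecidableEq ι]
    (M : ι → ModuleCat.{u} A) (f : ∀ i j, i ≤ j → M i →ₗ[A] M j)
    [DirectedSystem (fun i => M i) (fun i j h => f i j h)],
    (∀ i, X (M i)) → X (ModuleCat.of A (Module.DirectLimit (fun i => M i) f))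
  pure_sub : ∀ (L M : ModuleCat.{u} A) (f : L →ₗ[A] M), IsPureMono f → X M → X L

end Purity

section Pairs

variable {A B : Type u} [Ring A] [Ring B]

/-- `(S, P)` is an almost dual pair, where `S` is a class of `A`-modules and `P` is a class of
modules on the other side. -/
structure IsAlmostDualPair (e : B ≃+* Aᵐᵒᵖ) (S : ObjectProperty (ModuleCat.{u} A))
    (P : ObjectProperty (ModuleCat.{u} B)) : Prop where
  eq_prodClosure : P = prodClosure P
  hull_mem : ∀ (M H : ModuleCat.{u} B) (f : M →ₗ[B] H), IsPureInjectiveHull f → P M → P H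
  mem_iff : ∀ M : ModuleCat.{u} A, S M ↔ P (dual e M)

/-- `(S, P)` is a dual pair: an almost dual pair with `Prod(S^*) = Pinj(P)`. -/
structure IsDualPair (e : B ≃+* Aᵐᵒᵖ) (S : ObjectProperty (ModuleCat.{u} A))
    (P : ObjectProperty (ModuleCat.{u} B)) : Prop extends IsAlmostDualPair e S P where
  prod_dual_eq : prodClosure (dualClass e S) = pinj P

end Pairs

end DualPairs

/-!
Everything rests on linear equations over dual modules. As `ℚ/ℤ` is injective, a finite system of
equations with constants in `M^*` is solvable if and only if its constants annihilate the solutions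
in `M` of the transposed homogeneous system (`solvable_dual`), and the unsolvability of a system over
`M` is detected by characters (`exists_separating_of_not_solvable`). Hence `M → M^**` is pure. Dual
modules are pure-injective (`isPureInjective_dual`), so the transpose of a pure monomorphism is a
split epimorphism; this makes `S` closed under pure submodules.

The key point is that a definable subcategory is closed under double duals
(`IsDefinable.double_dual`): using `solvable_dual` twice, any finite amount of information about
`M^**`, namely finitely many relations together with the unsolvability of a system, is realized in
`M`, so that `M^**` is pure in a reduced product of powers of `M`, which is a direct limit of
products. Hence `M ∈ P`, `M^** ∈ P` and `M^* ∈ S` are equivalent.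

The rest is formal. For `M ∈ S`, the module `M^**` is the dual of `M^* ∈ P` and is a pure-injective
member of `S` that contains `M` purely. This gives the closure of `S` under pure-injective hulls, the
equality `S = (P^*)^+`, and, as pure-injective modules split off, `Pinj(S) ⊆ Prod(P^*)`. A product of
modules `M i ∈ S` is pure in `(⨁ M i ^*)^*`, where `⨁ M i ^*` lies in `P` as a pure submodule of the
product.
-/

namespace DualPairs

/-! ### Finite systems of linear equations and purity -/

section Systems

variable {A : Type u} [Ring A]

/-- The system of equations `∑ j, r i j • x j = c i`, with `i` ranging over `ι`, has a solution
in `M`. -/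
def Solvable {M ι κ : Type*} [AddCommGroup M] [Module A M] [Fintype κ]
    (r : ι → κ → A) (c : ι → M) : Prop :=
  ∃ x : κ → M, ∀ i, ∑ j, r i j • x j = c i

theorem Solvable.map {M N ι κ : Type*} [AddCommGroup M] [Module A M] [AddCommGroup N] [Module A N]
    [Fintype κ] {r : ι → κ → A} {c : ι → M} (h : Solvable r c) (f : M →ₗ[A] N) :
    Solvable r fun i => f (c i) := by
  obtain ⟨x, hx⟩ := h
  exact ⟨fun j => f (x j), fun i => by simp [← hx i]⟩

variable {L M : Type u} [AddCommGroup L] [Module A L] [AddCommGroup M] [Module A M]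

theorem IsPureMono.solvable {f : L →ₗ[A] M} (hf : IsPureMono f) {ι κ : Type*} [Fintype ι]
    [Fintype κ] {r : ι → κ → A} {c : ι → L} (h : Solvable r fun i => f (c i)) : Solvable r c := by
  obtain ⟨y, hy⟩ := h
  have e₁ := Fintype.equivFin ι
  have e₂ := Fintype.equivFin κ
  obtain ⟨x, hx⟩ := hf.2 _ _ (fun i j => r (e₁.symm i) (e₂.symm j)) (fun i => c (e₁.symm i))
    ⟨fun j => y (e₂.symm j), fun i => by
      exact (e₂.symm.sum_comp fun j => r (e₁.symm i) j • y j).trans (hy _)⟩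
  refine ⟨fun j => x (e₂ j), fun i => ?_⟩
  simpa [← e₂.sum_comp] using hx (e₁ i)

/-- Injectivity is the reflection of solvability for the systems `0 = c` without unknowns. -/
theorem isPureMono_of_solvable {f : L →ₗ[A] M}
    (h : ∀ (m n : ℕ) (r : Fin m → Fin n → A) (c : Fin m → L),
      Solvable r (fun i => f (c i)) → Solvable r c) : IsPureMono f := by
  refine ⟨(injective_iff_map_eq_zero f).2 fun a ha => ?_, h⟩
  obtain ⟨x, hx⟩ := h 1 0 (fun _ => Fin.elim0) (fun _ => a) ⟨Fin.elim0, fun i => by simp [ha]⟩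
  simpa using (hx 0).symm

theorem isPureMono_of_leftInverse {s : L →ₗ[A] M} {p : M →ₗ[A] L}
    (h : p ∘ₗ s = LinearMap.id) : IsPureMono s :=
  isPureMono_of_solvable fun _ _ _ _ hs => by
    simpa only [← LinearMap.comp_apply, h, LinearMap.id_apply] using hs.map p

theorem IsPureInjective.prod {I : Type u} {M : I → ModuleCat.{u} A}
    (hM : ∀ i, IsPureInjective (M i)) : IsPureInjective (ModuleCat.of A (∀ i, M i)) := by
  intro L N f hf g
  choose h hh using fun i => hM i L N f hf (LinearMap.proj i ∘ₗ g)
  refine ⟨LinearMap.pi h, ?_⟩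
  ext x i
  exact LinearMap.congr_fun (hh i) x

theorem IsPureInjective.summand {M N : ModuleCat.{u} A} {s : N →ₗ[A] M} {p : M →ₗ[A] N}
    (hps : p ∘ₗ s = LinearMap.id) (hM : IsPureInjective M) : IsPureInjective N := by
  intro L K f hf g
  obtain ⟨h, hh⟩ := hM L K f hf (s ∘ₗ g)
  exact ⟨p ∘ₗ h, by rw [LinearMap.comp_assoc, hh, ← LinearMap.comp_assoc, hps, LinearMap.id_comp]⟩

/-- A pure-injective module is a direct summand of every module containing it purely. -/
theorem IsPureInjective.exists_leftInverse {M N : ModuleCat.{u} A} (hM : IsPureInjective M)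
    {f : M →ₗ[A] N} (hf : IsPureMono f) : ∃ p : N →ₗ[A] M, p ∘ₗ f = LinearMap.id :=
  hM M N f hf LinearMap.id

theorem prodClosure_le {X Y : ObjectProperty (ModuleCat.{u} A)} (hXY : ∀ M, X M → Y M)
    (hprod : ∀ (I : Type u) (M : I → ModuleCat.{u} A), (∀ i, Y (M i)) →
      Y (ModuleCat.of A (∀ i, M i)))
    (hsummand : ∀ (M N : ModuleCat.{u} A) (s : N →ₗ[A] M) (p : M →ₗ[A] N),
      p ∘ₗ s = LinearMap.id → Y M → Y N) {M : ModuleCat.{u} A} (hM : prodClosure X M) : Y M := by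
  induction hM with
  | of_mem M hM => exact hXY M hM
  | prod I M _ ih => exact hprod I M ih
  | summand M N s p hps _ ih => exact hsummand M N s p hps ih

end Systems

/-! ### Characters of modules -/

section Characters

/-- Since `ℚ/ℤ` is injective, a character of `U` that vanishes on the kernel of `p : U → V` factors
through `p`. -/
theorem exists_character_extension {U V : Type*} [AddCommGroup U] [AddCommGroup V] (p : U →+ V)
    (ψ : U →+ AddCircle (1 : ℚ)) (h : ∀ u, p u = 0 → ψ u = 0) :
    ∃ φ : V →+ AddCircle (1 : ℚ), ∀ u, φ (p u) = ψ u := by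
  let q : U ⧸ p.ker →+ AddCircle (1 : ℚ) := QuotientAddGroup.lift p.ker ψ h
  obtain ⟨φ, hφ⟩ := CharacterModule.dual_surjective_of_injective
    (QuotientAddGroup.kerLift p).toIntLinearMap (QuotientAddGroup.kerLift_injective p) q
  exact ⟨φ, fun u => DFunLike.congr_fun hφ (QuotientAddGroup.mk u)⟩

variable {A B : Type u} [Ring A] [Ring B] (e : B ≃+* Aᵐᵒᵖ)

/-- An element of the dual module `M^*`, as a homomorphism `M → ℚ/ℤ`. -/
def toChar {M : ModuleCat.{u} A} : dual e M ≃+ (M →+ AddCircle (1 : ℚ)) :=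
  AddEquiv.refl (M →+ AddCircle (1 : ℚ))

variable {e}

theorem toChar_smul {M : ModuleCat.{u} A} (b : B) (f : dual e M) (m : M) :
    toChar e (b • f) m = toChar e f ((e b).unop • m) :=
  rfl

theorem dual_ext {M : ModuleCat.{u} A} {f g : dual e M}
    (h : ∀ m, toChar e f m = toChar e g m) : f = g :=
  (toChar e).injective (DFunLike.ext _ _ h)

variable (e) in
/-- The transpose `f^* : M^* → L^*` of `f : L → M`. -/
def transpose {L M : ModuleCat.{u} A} (f : L →ₗ[A] M) : dual e M →ₗ[B] dual e L where
  toFun φ := (toChar e).symm ((toChar e φ).comp f.toAddMonoidHom)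
  map_add' _ _ := rfl
  map_smul' b φ := dual_ext fun m => by
    change toChar e φ _ = toChar e φ _
    exact congrArg _ (f.map_smul _ m).symm

/-- Linear equations in a dual module: a system is solvable in `M^*` as soon as its constants
annihilate the solutions in `M` of the transposed homogeneous system. -/
theorem solvable_dual {M : ModuleCat.{u} A} {ι κ : Type*} [Fintype ι] [Fintype κ]
    (r : ι → κ → B) (c : ι → dual e M)
    (h : ∀ z : ι → M, (∀ j, ∑ i, (e (r i j)).unop • z i = 0) → ∑ i, toChar e (c i) (z i) = 0) :
    Solvable r c := by
  classical
  -- The constants define a character of `M^ι` that factors through the transposed system `p`; the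
  -- components of its extension to `M^κ` are a solution.
  let p : (ι → M) →+ (κ → M) :=
    { toFun := fun z j => ∑ i, (e (r i j)).unop • z i
      map_zero' := by ext; simp
      map_add' := fun z w => by ext; simp [Finset.sum_add_distrib] }
  let ψ : (ι → M) →+ AddCircle (1 : ℚ) :=
    { toFun := fun z => ∑ i, toChar e (c i) (z i)
      map_zero' := by simp
      map_add' := fun z w => by simp [Finset.sum_add_distrib] }
  obtain ⟨φ, hφ⟩ := exists_character_extension p ψ fun u hu => h u fun j => congrFun hu j
  refine ⟨fun j => (toChar e).symm (φ.comp (AddMonoidHom.single (fun _ : κ => (M : Type u)) j)),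
    fun i => dual_ext fun m => ?_⟩
  have h₁ : ψ (Pi.single i m) = toChar e (c i) m := by
    change ∑ k, toChar e (c k) (Pi.single (M := fun _ => (M : Type u)) i m k) = _
    rw [Finset.sum_eq_single i] <;> simp +contextual
  have h₂ : p (Pi.single i m) = ∑ j, Pi.single j ((e (r i j)).unop • m) := by
    ext j
    change ∑ k, (e (r k j)).unop • (Pi.single (M := fun _ => (M : Type u)) i m k) = _
    rw [Finset.sum_eq_single i, Finset.sum_apply, Finset.sum_eq_single j] <;>
      simp +contextual [eq_comm]
  rw [← h₁, ← hφ, h₂, map_sum, map_sum, AddMonoidHom.finsetSum_apply]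
  rfl

/-- If a system is not solvable in `M`, then its vector of constants is separated from the
solvable ones by a character of `M^ι`. -/
theorem exists_separating_of_not_solvable (e : B ≃+* Aᵐᵒᵖ) {M : ModuleCat.{u} A} {ι κ : Type*}
    [Fintype ι] [Fintype κ] {r : ι → κ → A} {c : ι → M} (h : ¬ Solvable r c) :
    ∃ z : ι → dual e M, (∀ j m, ∑ i, toChar e (z i) (r i j • m) = 0) ∧
      ∑ i, toChar e (z i) (c i) ≠ 0 := by
  classical
  let p : (κ → M) →+ (ι → M) :=
    { toFun := fun z i => ∑ j, r i j • z j
      map_zero' := by ext; simp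
      map_add' := fun z w => by ext; simp [Finset.sum_add_distrib] }
  have hc : (c : (ι → M) ⧸ p.range) ≠ 0 := by
    rw [Ne, QuotientAddGroup.eq_zero_iff]
    rintro ⟨x, hx⟩
    exact h ⟨x, fun i => congrFun hx i⟩
  obtain ⟨φ, hφ⟩ := CharacterModule.exists_character_apply_ne_zero_of_ne_zero hc
  let χ : (ι → M) →+ AddCircle (1 : ℚ) :=
    AddMonoidHom.comp φ (QuotientAddGroup.mk' p.range)
  have hsum : ∀ x : ι → M, ∑ i, χ (Pi.single i (x i)) = χ x := fun x => by
    rw [← map_sum, Finset.univ_sum_single]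
  refine ⟨fun i => (toChar e).symm (χ.comp (AddMonoidHom.single (fun _ : ι => (M : Type u)) i)),
    fun j m => ?_, fun h0 => hφ ((hsum c).symm.trans h0)⟩
  refine (hsum fun i => r i j • m).trans ?_
  have : (fun i => r i j • m) = p (Pi.single j m) := by
    ext i
    change _ = ∑ k, r i k • (Pi.single (M := fun _ => (M : Type u)) j m k)
    rw [Finset.sum_eq_single j] <;> simp +contextual
  rw [this]
  change φ (QuotientAddGroup.mk (p (Pi.single j m))) = 0
  rw [(QuotientAddGroup.eq_zero_iff _).2 (AddMonoidHom.mem_range.2 ⟨_, rfl⟩)]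
  exact map_zero φ

end Characters

/-! ### The evaluation map into the double dual -/

section DoubleDual

variable {A B : Type u} [Ring A] [Ring B] {e : B ≃+* Aᵐᵒᵖ} {e' : A ≃+* Bᵐᵒᵖ}

theorem unop_symm_compat (h : ∀ a, (e (e' a).unop).unop = a) (b : B) :
    (e' (e b).unop).unop = b :=
  e.injective (MulOpposite.unop_injective (h _))

/-- The evaluation map `M → M^**`. The hypothesis says that `e` and `e'` are inverse to each other
as identifications of `B` with the opposite ring of `A`. -/
def evalMap (h : ∀ a, (e (e' a).unop).unop = a) (M : ModuleCat.{u} A) :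
    M →ₗ[A] dual e' (dual e M) where
  toFun m := (toChar e').symm
    ((AddMonoidHom.eval m).comp (toChar e (M := M)).toAddMonoidHom)
  map_add' m n := dual_ext fun φ => map_add (toChar e φ) m n
  map_smul' a m := dual_ext fun φ => by
    change toChar e φ (a • m) = toChar e φ ((e (e' a).unop).unop • m)
    rw [h]

theorem evalMap_apply (h : ∀ a, (e (e' a).unop).unop = a) {M : ModuleCat.{u} A} (m : M)
    (φ : dual e M) : toChar e' (evalMap h M m) φ = toChar e φ m :=
  rfl

theorem isPureMono_evalMap (h : ∀ a, (e (e' a).unop).unop = a) (M : ModuleCat.{u} A) :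
    IsPureMono (evalMap h M) := by
  refine isPureMono_of_solvable fun m n r c ⟨Y, hY⟩ => ?_
  by_contra hc
  obtain ⟨z, hz, hzc⟩ := exists_separating_of_not_solvable e hc
  have hz' : ∀ j, ∑ i, (e' (r i j)).unop • z i = 0 := fun j => dual_ext fun m => by
    rw [map_sum, AddMonoidHom.finsetSum_apply, map_zero]
    simpa [toChar_smul, h] using hz j m
  refine hzc ?_
  calc ∑ i, toChar e (z i) (c i) = ∑ i, toChar e' (∑ j, r i j • Y j) (z i) := by
        simp only [hY, evalMap_apply]
    _ = ∑ j, toChar e' (Y j) (∑ i, (e' (r i j)).unop • z i) := by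
        simp only [map_sum, AddMonoidHom.finsetSum_apply, toChar_smul]
        exact Finset.sum_comm
    _ = 0 := by simp [hz']

end DoubleDual

/-! ### Dual modules are pure-injective -/

section PureInjective

variable {A B : Type u} [Ring A] [Ring B] (e : B ≃+* Aᵐᵒᵖ)

/-- For an element `k` of the free `A`-module on `X` and an element `m` of a module `M` on the other
side, the tensor `k ⊗ m`, as an element of `⨁_X M`. -/
noncomputable def freeTensor {X M : Type u} [AddCommGroup M] [Module B M] (k : X →₀ A) :
    M →+ (X →₀ M) where
  toFun m := k.mapRange (fun a => e.symm (MulOpposite.op a) • m) (by simp)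
  map_zero' := by ext; simp
  map_add' m m' := by ext; simp

variable {e}

theorem freeTensor_apply {X M : Type u} [AddCommGroup M] [Module B M] (k : X →₀ A) (m : M)
    (x : X) : freeTensor e k m x = e.symm (MulOpposite.op (k x)) • m :=
  rfl

theorem freeTensor_single {X M : Type u} [AddCommGroup M] [Module B M] (x : X) (a : A) (m : M) :
    freeTensor e (Finsupp.single x a) m = Finsupp.single x (e.symm (MulOpposite.op a) • m) :=
  Finsupp.mapRange_single (hf := by simp)

theorem freeTensor_sub {X M : Type u} [AddCommGroup M] [Module B M] (k k' : X →₀ A) (m : M) :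
    freeTensor e (k - k') m = freeTensor e k m - freeTensor e k' m := by
  ext x
  simp [freeTensor_apply, sub_smul]

/-- If `K` is the module of relations between the elements of `X`, then `X ⊗ M` is the quotient of
`⨁_X M` by the tensors `k ⊗ m` with `k ∈ K`. Homomorphisms `M → X^*` are the characters of this
group, and `X ⊗ L → X ⊗ M` is injective when `L → M` is pure, because membership in the subgroup of
relations is the solvability of a finite system. -/
theorem isPureInjective_dual (X : ModuleCat.{u} A) : IsPureInjective (dual e X) := by
  classical
  intro L M f hf g
  let K := LinearMap.ker (Finsupp.linearCombination A (id : X → X))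
  let θ : (K →₀ M) →+ (X →₀ M) := Finsupp.liftAddHom fun k => freeTensor e k.1
  let ψ : (X →₀ L) →+ AddCircle (1 : ℚ) := Finsupp.liftAddHom fun x =>
    (AddMonoidHom.eval x).comp ((toChar e (M := X)).toAddMonoidHom.comp g.toAddMonoidHom)
  have hψs : ∀ x l, ψ (Finsupp.single x l) = toChar e (g l) x := fun x l =>
    Finsupp.liftAddHom_apply_single _ _ _
  have hψ : ∀ (k : K) (l : L), ψ (freeTensor e k.1 l) = 0 := fun k l => by
    have hk : ∑ x ∈ k.1.support, k.1 x • x = 0 := k.2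
    have hkl : freeTensor e k.1 l =
        ∑ x ∈ k.1.support, Finsupp.single x (e.symm (MulOpposite.op (k.1 x)) • l) := by
      ext y
      simp +contextual [freeTensor_apply, Finsupp.finsetSum_apply, Finsupp.single_apply]
    rw [hkl, map_sum]
    simp only [hψs, map_smul, toChar_smul, RingEquiv.apply_symm_apply, MulOpposite.unop_op]
    rw [← map_sum, hk, map_zero]
  -- If `u` becomes a sum of tensors `k ⊗ v k` over `M`, purity replaces the `v k` by elements of `L`.
  have key : ∀ u : X →₀ L,
      (QuotientAddGroup.mk' θ.range) (Finsupp.mapRange.addMonoidHom f.toAddMonoidHom u) = 0 →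
      ψ u = 0 := by
    intro u hu
    obtain ⟨v, hv⟩ := AddMonoidHom.mem_range.1 ((QuotientAddGroup.eq_zero_iff _).1 hu)
    have hv' : ∀ x, ∑ k : v.support, e.symm (MulOpposite.op (k.1.1 x)) • v k.1 = f (u x) := by
      intro x
      rw [Finset.sum_coe_sort v.support fun k => e.symm (MulOpposite.op (k.1 x)) • v k]
      have := DFunLike.congr_fun hv x
      simpa [θ, Finsupp.sum, Finsupp.finsetSum_apply, freeTensor_apply] using this
    let T : Finset X := u.support ∪ v.support.biUnion fun k => k.1.support
    obtain ⟨l, hl⟩ := hf.solvable (ι := T) (κ := v.support)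
      (r := fun x k => e.symm (MulOpposite.op (k.1.1 x.1))) (c := fun x => u x.1)
      ⟨fun k => v k.1, fun x => hv' x.1⟩
    have hu' : u = ∑ k : v.support, freeTensor e k.1.1 (l k) := by
      ext x
      rw [Finsupp.finsetSum_apply]
      simp only [freeTensor_apply]
      by_cases hx : x ∈ T
      · exact (hl ⟨x, hx⟩).symm
      · simp only [T, Finset.mem_union, Finset.mem_biUnion, not_or, not_exists, not_and,
          Finsupp.notMem_support_iff] at hx
        rw [hx.1, Finset.sum_eq_zero]
        intro k _
        rw [hx.2 k.1 k.2, MulOpposite.op_zero, map_zero, zero_smul]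
    rw [hu', map_sum]
    exact Finset.sum_eq_zero fun k _ => hψ _ _
  obtain ⟨φ₀, hφ₀⟩ := exists_character_extension
    ((QuotientAddGroup.mk' θ.range).comp (Finsupp.mapRange.addMonoidHom f.toAddMonoidHom)) ψ key
  let φ : (X →₀ M) →+ AddCircle (1 : ℚ) := φ₀.comp (QuotientAddGroup.mk' θ.range)
  have hφ : ∀ k ∈ K, ∀ m, φ (freeTensor e k m) = 0 := by
    intro k hk m
    have : QuotientAddGroup.mk' θ.range (freeTensor e k m) = 0 :=
      (QuotientAddGroup.eq_zero_iff _).2 (AddMonoidHom.mem_range.2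
        ⟨Finsupp.single ⟨k, hk⟩ m, Finsupp.liftAddHom_apply_single _ _ _⟩)
    change φ₀ _ = 0
    rw [this, map_zero]
  -- Read off `M → X^*` from `φ`; each of its linearity properties is one relation in `K`.
  let h₀ : M → dual e X := fun m => (toChar e).symm
    { toFun := fun x => φ (Finsupp.single x m)
      map_zero' := by
        simpa [freeTensor_single] using hφ (Finsupp.single 0 1) (by simp [K]) m
      map_add' := fun x y => by
        have := hφ (Finsupp.single (x + y) 1 - Finsupp.single x 1 - Finsupp.single y 1)
          (by simp [K]) m
        simp only [freeTensor_sub, freeTensor_single, MulOpposite.op_one, map_one, one_smul,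
          map_sub] at this
        rw [sub_sub] at this
        exact sub_eq_zero.1 this }
  have hh₀ : ∀ m x, toChar e (h₀ m) x = φ (Finsupp.single x m) := fun _ _ => rfl
  refine ⟨{ toFun := h₀, map_add' := fun m m' => dual_ext fun x => ?_,
            map_smul' := fun b m => dual_ext fun x => ?_ }, ?_⟩
  · simp [hh₀]
  · have := hφ (Finsupp.single x (e b).unop - Finsupp.single ((e b).unop • x) 1) (by simp [K]) m
    simp only [freeTensor_sub, freeTensor_single, MulOpposite.op_one, map_one, one_smul,
      map_sub, MulOpposite.op_unop, RingEquiv.symm_apply_apply] at this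
    exact sub_eq_zero.1 this
  · ext l
    refine dual_ext fun x => ?_
    rw [← hψs, ← hφ₀]
    change φ _ = φ _
    simp

variable {e' : A ≃+* Bᵐᵒᵖ}

/-- The transpose of a pure monomorphism splits: extend `L → L^**` to `M → L^**` and transpose
back. -/
theorem IsPureMono.exists_transpose_section (h : ∀ a, (e (e' a).unop).unop = a)
    {L M : ModuleCat.{u} A} {f : L →ₗ[A] M} (hf : IsPureMono f) :
    ∃ s : dual e L →ₗ[B] dual e M, transpose e f ∘ₗ s = LinearMap.id := by
  obtain ⟨g, hg⟩ := isPureInjective_dual (e := e') (dual e L) L M f hf (evalMap h L)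
  refine ⟨transpose e g ∘ₗ evalMap (unop_symm_compat h) (dual e L), ?_⟩
  ext φ
  refine dual_ext fun l => ?_
  exact congrArg (fun y => toChar e' y φ) (LinearMap.congr_fun hg l)

end PureInjective

/-! ### Definable subcategories are closed under double duals -/

section Definable

variable {A B : Type u} [Ring A] [Ring B] {e : B ≃+* Aᵐᵒᵖ} {e' : A ≃+* Bᵐᵒᵖ}

/-- If every finite set of relations between elements of `N` holds for some family in `M` indexed
by `N` for which a given unsolvable system over `N` remains unsolvable, then `N` is a pure
submodule of a reduced product of copies of a power of `M`. The reduced product is the direct limit,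
over the finite sets `i` of relations, of the products of the copies indexed by the `j ⊇ i`. -/
theorem IsDefinable.of_approx {X : ObjectProperty (ModuleCat.{u} A)} (hX : IsDefinable X)
    {M N : ModuleCat.{u} A} (hM : X M)
    (h : ∀ (J : Finset (LinearMap.ker (Finsupp.linearCombination A (id : N → N)))) (m n : ℕ)
      (r : Fin m → Fin n → A) (c : Fin m → N), ¬ Solvable r c →
      ∃ x : N → M, (∀ k ∈ J, Finsupp.linearCombination A x k.1 = 0) ∧
        ¬ Solvable r fun i => x (c i)) : X N := by
  classical
  let K := LinearMap.ker (Finsupp.linearCombination A (id : N → N))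
  let W := { w : Σ m n : ℕ, (Fin m → Fin n → A) × (Fin m → N) // ¬ Solvable w.2.2.1 w.2.2.2 }
  choose x hx hxs using fun (J : Finset K) (w : W) => h J _ _ _ _ w.2
  -- The copy of `M ^ W` indexed by `j` carries a family that satisfies the relations in `j` and makes
  -- all the unsolvable systems over `N` unsolvable at once.
  let G : Finset K → ModuleCat.{u} A := fun i =>
    ModuleCat.of A (∀ _ : { j : Finset K // i ≤ j }, ModuleCat.of A (∀ _ : W, M))
  let F : ∀ i j, i ≤ j → G i →ₗ[A] G j := fun i j hij =>
    LinearMap.funLeft A (W → M)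
      (fun k : { k : Finset K // j ≤ k } => (⟨k.1, hij.trans k.2⟩ : { k : Finset K // i ≤ k }))
  have : DirectedSystem (fun i => G i) (fun i j h => F i j h) :=
    ⟨fun _ _ => rfl, fun _ _ _ _ _ _ => rfl⟩
  have hD : X (ModuleCat.of A (Module.DirectLimit (fun i => G i) F)) :=
    hX.directLimit _ G F fun i => hX.prod _ _ fun _ => hX.prod _ _ fun _ => hM
  let t₀ : (N →₀ A) →ₗ[A] G ∅ :=
    LinearMap.pi fun j => LinearMap.pi fun w => Finsupp.linearCombination A (x j.1 w)
  let t := Module.DirectLimit.of A (Finset K) (fun i => G i) F ∅ ∘ₗ t₀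
  have ht : ∀ k ∈ K, t k = 0 := by
    intro k hk
    change Module.DirectLimit.of A (Finset K) (fun i => G i) F ∅ (t₀ k) = 0
    rw [← Module.DirectLimit.of_f (hij := Finset.empty_subset {⟨k, hk⟩})]
    have : F ∅ {⟨k, hk⟩} (Finset.empty_subset _) (t₀ k) = 0 := by
      funext j w
      exact hx j.1 w ⟨k, hk⟩ (j.2 (Finset.mem_singleton_self _))
    rw [this, map_zero]
  let s : N →ₗ[A] Module.DirectLimit (fun i => G i) F :=
    { toFun := fun n => t (Finsupp.single n 1)
      map_add' := fun n n' => by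
        rw [← sub_eq_zero, ← map_add, ← map_sub]
        exact ht _ (by simp [K])
      map_smul' := fun a n => by
        rw [← sub_eq_zero, RingHom.id_apply, ← map_smul, ← map_sub]
        exact ht _ (by simp [K]) }
  refine hX.pure_sub _ _ s (isPureMono_of_solvable ?_) hD
  rintro m n r c ⟨y, hy⟩
  by_contra hc
  -- Represent a solution at a stage `i₀`; the equations hold from a stage `b₀` on, and then a
  -- coordinate beyond `b₀` solves a system that was chosen unsolvable there.
  choose a q hq using fun j => Module.DirectLimit.exists_of (y j)
  obtain ⟨i₀, hi₀⟩ := Finite.exists_le a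
  let q' : Fin n → G i₀ := fun j => F _ _ (hi₀ j) (q j)
  have hq' : ∀ j, Module.DirectLimit.of A (Finset K) (fun i => G i) F i₀ (q' j) = y j := fun j =>
    Eq.trans (Module.DirectLimit.of_f (hij := hi₀ j)) (hq j)
  have hb : ∀ i, ∃ b, ∃ hb : i₀ ≤ b, F _ _ hb (∑ j, r i j • q' j) =
      F _ _ hb (F ∅ i₀ (Finset.empty_subset _) (t₀ (Finsupp.single (c i) 1))) := fun i =>
    Module.DirectLimit.exists_eq_of_of_eq <| by
      rw [Module.DirectLimit.of_f (hij := Finset.empty_subset i₀), map_sum]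
      simp only [map_smul, hq']
      exact hy i
  choose b hb hbe using hb
  obtain ⟨b₀, hb₀⟩ := Finite.exists_le b
  obtain ⟨b₁, hb₁, hi₁⟩ := exists_ge_ge b₀ i₀
  let w : W := ⟨⟨m, n, r, c⟩, hc⟩
  refine hxs b₁ w ⟨fun j => (q' j : _ → W → M) ⟨b₁, hi₁⟩ w, fun i => ?_⟩
  have h₁ : ((∑ j, r i j • q' j : G i₀) : _ → W → M) ⟨b₁, hi₁⟩ w =
      (t₀ (Finsupp.single (c i) 1) : _ → W → M) ⟨b₁, Finset.empty_subset _⟩ w :=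
    congrFun (congrFun (hbe i) ⟨b₁, (hb₀ i).trans hb₁⟩) w
  have h₂ : (t₀ (Finsupp.single (c i) 1) : _ → W → M) ⟨b₁, Finset.empty_subset _⟩ w =
      x b₁ w (c i) := by
    change Finsupp.linearCombination A (x b₁ w) (Finsupp.single (c i) 1) = _
    simp
  refine Eq.trans ?_ (h₁.trans h₂)
  change _ = (LinearMap.proj (R := A) (φ := fun _ => (M : Type u)) w ∘ₗ
    LinearMap.proj (R := A) (φ := fun _ => W → M) ⟨b₁, hi₁⟩) (∑ j, r i j • q' j)
  rw [map_sum]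
  rfl

/-- Every implication between positive primitive formulas that is valid in `M` is valid in `M^**`,
by `solvable_dual` for `M^*` and for `M`; the hypothesis of `IsDefinable.of_approx` follows. -/
theorem IsDefinable.double_dual {X : ObjectProperty (ModuleCat.{u} A)} (hX : IsDefinable X)
    (h : ∀ a, (e (e' a).unop).unop = a) {M : ModuleCat.{u} A} (hM : X M) :
    X (dual e' (dual e M)) := by
  classical
  refine hX.of_approx hM fun J m n r c hc => ?_
  by_contra! H
  refine hc (solvable_dual r c fun z hz => ?_)
  -- `T` contains the constants and all elements that occur in the relations. The character
  -- `x ↦ ∑ i, z i (x (c i))` of `M^T` vanishes on the solutions of the relations `J`, so it is the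
  -- combination of the relations with coefficients `y k` in `M^*`.
  let T : Finset (dual e' (dual e M)) :=
    Finset.univ.image c ∪ J.biUnion fun k => k.1.support
  have hJT : ∀ k ∈ J, k.1.support ⊆ T := fun k hk =>
    (Finset.subset_biUnion_of_mem (fun k => k.1.support) hk).trans Finset.subset_union_right
  let c' : Fin m → T := fun i =>
    ⟨c i, Finset.mem_union_left _ (Finset.mem_image_of_mem _ (Finset.mem_univ i))⟩
  suffices hy : Solvable (M := dual e M) (ι := T) (κ := J) (fun t k => (e' (k.1.1 t.1)).unop)
      fun t => ∑ i, if c' i = t then z i else 0 by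
    obtain ⟨y, hy⟩ := hy
    have hk : ∀ k : J, ∑ t : T, k.1.1 t.1 • t.1 = 0 := fun k => by
      have h0 : Finsupp.linearCombination A id k.1.1 = 0 := k.1.2
      rw [Finsupp.linearCombination_apply, Finsupp.sum_of_support_subset _ (hJT k.1 k.2) _
        (by simp)] at h0
      rw [← h0]
      exact Finset.sum_coe_sort T fun t => k.1.1 t • t
    calc ∑ i, toChar e' (c i) (z i)
        = ∑ t : T, toChar e' t.1 (∑ i, if c' i = t then z i else 0) := by
          simp only [map_sum, apply_ite, map_zero]
          rw [Finset.sum_comm]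
          simp [c']
      _ = ∑ k : J, toChar e' (∑ t : T, k.1.1 t.1 • t.1) (y k) := by
          simp only [← hy, map_sum, AddMonoidHom.finsetSum_apply, toChar_smul]
          exact Finset.sum_comm
      _ = 0 := Finset.sum_eq_zero fun k _ => by
          rw [hk, map_zero, AddMonoidHom.zero_apply]
  refine solvable_dual _ _ fun x hx => ?_
  let x' : dual e' (dual e M) → M := fun t => if ht : t ∈ T then x ⟨t, ht⟩ else 0
  have hx' : ∀ t : T, x' t.1 = x t := fun t => by simp [x']
  obtain ⟨v, hv⟩ := H x' fun k hk => by
    rw [Finsupp.linearCombination_apply, Finsupp.sum_of_support_subset _ (hJT k hk) _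
      (by simp), ← Finset.sum_coe_sort T fun t => k.1 t • x' t]
    simpa [h, hx'] using hx ⟨k, hk⟩
  have hsum : ∑ t : T, toChar e (∑ i, if c' i = t then z i else 0) (x t) =
      ∑ i, toChar e (z i) (x' (c i)) := by
    simp only [map_sum, AddMonoidHom.finsetSum_apply, apply_ite (toChar e), map_zero,
      ← hx']
    rw [Finset.sum_comm]
    refine Finset.sum_congr rfl fun i _ => ?_
    rw [Finset.sum_eq_single (c' i)]
    · simp [c']
    · intro t _ ht
      simp [ht.symm]
    · simp
  rw [hsum]
  calc ∑ i, toChar e (z i) (x' (c i)) = ∑ i, toChar e (z i) (∑ j, r i j • v j) := by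
        simp only [hv]
    _ = ∑ j, toChar e (∑ i, (e' (r i j)).unop • z i) (v j) := by
        simp only [map_sum, AddMonoidHom.finsetSum_apply, toChar_smul, h]
        exact Finset.sum_comm
    _ = 0 := by simp [hz]

end Definable

/-! ### Direct sums and products -/

section DirectSum

/-- A solution in the product may be truncated to the finite support of the constants. -/
theorem isPureMono_coeFnLinearMap {A : Type u} [Ring A] {I : Type u} (N : I → Type u)
    [∀ i, AddCommGroup (N i)] [∀ i, Module A (N i)] :
    IsPureMono (DFinsupp.coeFnLinearMap A : (Π₀ i, N i) →ₗ[A] ∀ i, N i) := by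
  classical
  refine isPureMono_of_solvable fun m n r c ⟨y, hy⟩ => ?_
  let T : Finset I := Finset.univ.biUnion fun i => (c i).support
  refine ⟨fun j => DFinsupp.mk T fun t => y j t.1, fun i => DFinsupp.ext fun t => ?_⟩
  rw [DFinsupp.finsetSum_apply]
  by_cases ht : t ∈ T
  · simpa [ht] using congrFun (hy i) t
  · have hct : c i t = 0 := by
      by_contra h
      exact ht (Finset.mem_biUnion.2 ⟨i, Finset.mem_univ i, DFinsupp.mem_support_iff.2 h⟩)
    simp [ht, hct]

variable {A B : Type u} [Ring A] [Ring B] {e : B ≃+* Aᵐᵒᵖ} {e' : A ≃+* Bᵐᵒᵖ}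

/-- Evaluation of families `(x i)` in `∏ M i` on families of characters in `⨁ M i ^*` is a pure
monomorphism, because its target `(⨁ M i ^*)^*` restricts to each `M i ^**`. -/
theorem exists_isPureMono_pi_dual (h : ∀ a, (e (e' a).unop).unop = a) {I : Type u}
    (M : I → ModuleCat.{u} A) :
    ∃ f : (∀ i, M i) →ₗ[A] dual e' (ModuleCat.of B (Π₀ i, dual e (M i))), IsPureMono f := by
  classical
  let D : ModuleCat.{u} B := ModuleCat.of B (Π₀ i, dual e (M i))
  let ev₀ : (∀ i, M i) → (D →+ AddCircle (1 : ℚ)) := fun x => DFinsupp.liftAddHom fun i =>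
    (AddMonoidHom.eval (x i)).comp (toChar e (M := M i)).toAddMonoidHom
  have hev₀ : ∀ x i (φ : dual e (M i)), ev₀ x (DFinsupp.single i φ) = toChar e φ (x i) :=
    fun x i φ => DFinsupp.liftAddHom_apply_single _ _ _
  let ev : (∀ i, M i) →ₗ[A] dual e' D :=
    { toFun := fun x => (toChar e').symm (ev₀ x)
      map_add' := fun x y => (toChar e').symm_apply_eq.2 <| DFinsupp.addHom_ext fun i φ => by
        change _ = ev₀ x (DFinsupp.single i φ) + ev₀ y (DFinsupp.single i φ)
        rw [hev₀, hev₀, hev₀, Pi.add_apply, map_add]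
      map_smul' := fun a x => (toChar e').symm_apply_eq.2 <| DFinsupp.addHom_ext fun i φ => by
        change _ = ev₀ x ((e' a).unop • (DFinsupp.single i φ : Π₀ i, dual e (M i)))
        rw [← DFinsupp.single_smul, hev₀, hev₀, Pi.smul_apply, toChar_smul, h] }
  refine ⟨ev, isPureMono_of_solvable fun m n r c hc => ?_⟩
  have hi : ∀ i, Solvable r fun k => c k i := fun i => by
    let ι : dual e (M i) →ₗ[B] D := DFinsupp.lsingle (M := fun i => dual e (M i)) i
    refine (isPureMono_evalMap h (M i)).solvable ?_
    convert hc.map (transpose e' ι) using 2 with k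
    exact dual_ext fun φ => (hev₀ _ _ _).symm
  choose x hx using hi
  refine ⟨fun j i => x i j, fun k => funext fun i => Eq.trans ?_ (hx i k)⟩
  exact Finset.sum_apply ..

end DirectSum

/-! ### Almost dual pairs with a definable second class -/

section Pairs

variable {A B : Type u} [Ring A] [Ring B] {e : B ≃+* Aᵐᵒᵖ} {e' : A ≃+* Bᵐᵒᵖ}
  {S : ObjectProperty (ModuleCat.{u} A)} {P : ObjectProperty (ModuleCat.{u} B)}

namespace IsAlmostDualPair

theorem right_of_leftInverse (hSP : IsAlmostDualPair e S P) {M N : ModuleCat.{u} B}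
    (s : N →ₗ[B] M) (p : M →ₗ[B] N) (hps : p ∘ₗ s = LinearMap.id) (hM : P M) : P N := by
  rw [hSP.eq_prodClosure] at hM ⊢
  exact .summand M N s p hps hM

/-- The first class is closed under pure submodules, because the dual of a pure submodule is a
direct summand of the dual. -/
theorem left_of_isPureMono (hSP : IsAlmostDualPair e S P) (h : ∀ a, (e (e' a).unop).unop = a)
    {L M : ModuleCat.{u} A} {f : L →ₗ[A] M} (hf : IsPureMono f) (hM : S M) : S L := by
  obtain ⟨s, hs⟩ := hf.exists_transpose_section (e := e) h
  exact (hSP.mem_iff L).2 (hSP.right_of_leftInverse s _ hs ((hSP.mem_iff M).1 hM))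

theorem left_of_leftInverse (hSP : IsAlmostDualPair e S P) (h : ∀ a, (e (e' a).unop).unop = a)
    {M N : ModuleCat.{u} A} {s : N →ₗ[A] M} {p : M →ₗ[A] N} (hps : p ∘ₗ s = LinearMap.id)
    (hM : S M) : S N :=
  hSP.left_of_isPureMono h (isPureMono_of_leftInverse hps) hM

/-- The symmetric membership condition: both sides are equivalent to `M^** ∈ P`. -/
theorem right_mem_iff (hSP : IsAlmostDualPair e S P) (h : ∀ a, (e (e' a).unop).unop = a)
    (hP : IsDefinable P) (M : ModuleCat.{u} B) : P M ↔ S (dual e' M) :=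
  ⟨fun hM => (hSP.mem_iff _).2 (hP.double_dual (unop_symm_compat h) hM), fun hM =>
    hP.pure_sub _ _ _ (isPureMono_evalMap (unop_symm_compat h) M) ((hSP.mem_iff _).1 hM)⟩

theorem left_of_dualClass (hSP : IsAlmostDualPair e S P) (h : ∀ a, (e (e' a).unop).unop = a)
    (hP : IsDefinable P) {N : ModuleCat.{u} A} (hN : dualClass e' P N) : S N := by
  obtain ⟨M, hM, ⟨i⟩⟩ := hN
  refine hSP.left_of_leftInverse h (M := dual e' M) (s := i.hom.hom) (p := i.inv.hom) ?_
    ((hSP.right_mem_iff h hP M).1 hM)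
  rw [← ModuleCat.hom_comp, i.hom_inv_id, ModuleCat.hom_id]

theorem dualClass_double_dual (hSP : IsAlmostDualPair e S P) {M : ModuleCat.{u} A} (hM : S M) :
    dualClass e' P (dual e' (dual e M)) :=
  ⟨dual e M, (hSP.mem_iff M).1 hM, ⟨Iso.refl _⟩⟩

/-- The direct sum `D` of the modules `M i ^*` is pure in their product, so `D ∈ P` and `D^* ∈ S`;
the product of the `M i` is pure in `D^*`. -/
theorem left_prod (hSP : IsAlmostDualPair e S P) (h : ∀ a, (e (e' a).unop).unop = a)
    (hP : IsDefinable P) {I : Type u} (M : I → ModuleCat.{u} A) (hM : ∀ i, S (M i)) :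
    S (ModuleCat.of A (∀ i, M i)) := by
  have hD : P (ModuleCat.of B (Π₀ i, dual e (M i))) :=
    hP.pure_sub _ (ModuleCat.of B (∀ i, dual e (M i))) _ (isPureMono_coeFnLinearMap _)
      (hP.prod _ _ fun i => (hSP.mem_iff _).1 (hM i))
  obtain ⟨f, hf⟩ := exists_isPureMono_pi_dual (e' := e') h M
  exact hSP.left_of_isPureMono h hf ((hSP.right_mem_iff h hP _).1 hD)

/-- The dual `M^**` of `M^* ∈ P` lies in `S` and contains `M` purely, hence also a pure-injective
hull of `M`. -/
theorem left_hull (hSP : IsAlmostDualPair e S P) (h : ∀ a, (e (e' a).unop).unop = a)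
    (hP : IsDefinable P) {M H : ModuleCat.{u} A} {f : M →ₗ[A] H} (hf : IsPureInjectiveHull f)
    (hM : S M) : S H := by
  obtain ⟨g, hg⟩ := isPureInjective_dual (dual e M) M H f hf.2.1 (evalMap (e' := e') h M)
  have hgp : IsPureMono g := hf.2.2 _ g (hg ▸ isPureMono_evalMap h M)
  exact hSP.left_of_isPureMono h hgp
    (hSP.left_of_dualClass h hP (hSP.dualClass_double_dual (e' := e') hM))

theorem isDualPair_symm (hSP : IsAlmostDualPair e S P) (h : ∀ a, (e (e' a).unop).unop = a)
    (hP : IsDefinable P) : IsDualPair e' P S where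
  eq_prodClosure := by
    ext M
    exact ⟨.of_mem M, prodClosure_le (fun _ hM => hM) (fun _ => hSP.left_prod h hP)
      fun _ _ _ _ hps => hSP.left_of_leftInverse h hps⟩
  hull_mem _ _ _ hf := hSP.left_hull h hP hf
  mem_iff := hSP.right_mem_iff h hP
  prod_dual_eq := by
    ext M
    refine ⟨prodClosure_le ?_ ?_ ?_, fun hM => ?_⟩
    · intro N hN
      refine ⟨hSP.left_of_dualClass h hP hN, ?_⟩
      obtain ⟨L, -, ⟨i⟩⟩ := hN
      refine (isPureInjective_dual L).summand (s := i.hom.hom) (p := i.inv.hom) ?_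
      rw [← ModuleCat.hom_comp, i.hom_inv_id, ModuleCat.hom_id]
    · exact fun I N hN => ⟨hSP.left_prod h hP N fun i => (hN i).1, .prod fun i => (hN i).2⟩
    · exact fun _ _ _ _ hps hN => ⟨hSP.left_of_leftInverse h hps hN.1, hN.2.summand hps⟩
    · obtain ⟨p, hp⟩ := hM.2.exists_leftInverse (isPureMono_evalMap (e' := e') h M)
      exact .summand _ _ _ p hp (.of_mem _ (hSP.dualClass_double_dual hM.1))

theorem left_eq_pureClosure (hSP : IsAlmostDualPair e S P) (h : ∀ a, (e (e' a).unop).unop = a)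
    (hP : IsDefinable P) : S = pureClosure (dualClass e' P) := by
  ext M
  constructor
  · exact fun hM => ⟨_, hSP.dualClass_double_dual hM, _, isPureMono_evalMap h M⟩
  · rintro ⟨N, hN, f, hf⟩
    exact hSP.left_of_isPureMono h hf (hSP.left_of_dualClass h hP hN)

end IsAlmostDualPair

end Pairs

end DualPairs

open DualPairs in
/-- Left `R`-modules are objects of `ModuleCat R`; right `R`-modules are objects of
`ModuleCat Rᵐᵒᵖ`. -/
theorem corollary4p5 (R : Type u) [Ring R]
    (S : ObjectProperty (ModuleCat.{u} R)) (P : ObjectProperty (ModuleCat.{u} Rᵐᵒᵖ))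
    (hSP : IsAlmostDualPair (RingEquiv.refl Rᵐᵒᵖ) S P) (hP : IsDefinable P) :
    IsDualPair (RingEquiv.opOp R) P S ∧
      S = pureClosure (dualClass (RingEquiv.opOp R) P) :=
  have h : ∀ a : R, (RingEquiv.refl Rᵐᵒᵖ (RingEquiv.opOp R a).unop).unop = a := fun _ => rfl
  ⟨hSP.isDualPair_symm h hP, hSP.left_eq_pureClosure h hP⟩
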